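/- Let $\varphi$ denote Euler's totient function. For integers $n,m\ge 1$, a function $\psi:\mathbb{N}\to\mathbb{R}_{\ge 0}$ and $\mathbf{y}\in\mathbb{R}^m$, let $\mathcal{A}_{n,m}^{\mathbf{y}}(\psi)$ denote the set of real $n\times m$ matrices $\mathbf{x}\in[0,1]^{nm}$ such that $$|\mathbf{q}\mathbf{x}+\mathbf{p}-\mathbf{y}|<\psi(|\mathbf{q}|)$$ holds for infinitely many pairs $(\mathbf{p},\mathbf{q})\in\mathbb{Z}^m\times\mathbb{Z}^n$, where $\mathbf{q}$ and $\mathbf{p}$ are row vectors and $|\cdot|$ is the maximum norm. Let $\varepsilon>0$. (1) For every $\psi:\mathbb{N}\to\mathbb{R}_{\ge 0}$ and every $y\in\mathbb{R}$, if $$\sum_{q=1}^\infty\left(\frac{\varphi(q)}{q}\right)^{1+\varepsilon}q\,\psi(q)=\infty,$$ then $\mathcal{A}_{2,1}^{y}(\psi)$ has Lebesgue measure $1$. (2) For every $\psi:\mathbb{N}\to\mathbb{R}_{\ge 0}$ and every $\mathbf{y}\in\mathbb{R}^2$, if $$\sum_{q=1}^\infty\left(\frac{\varphi(q)}{q}\right)^{1+\varepsilon}\psi(q)^2=\infty,$$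 then $\mathcal{A}_{1,2}^{\mathbf{y}}(\psi)$ has Lebesgue measure $1$. -/

import Mathlib

open MeasureTheory
open scoped NNReal

/-- The maximum norm `|q| = max |q_i|` of an integer vector. -/
def maxNorm {n : ℕ} (q : Fin n → ℤ) : ℕ :=
  Finset.univ.sup fun i => (q i).natAbs

/-- The row vector `q x + p` in `ℝ^m`, for an `n × m` real matrix `x`, an integer row vector
`q` of length `n` and an integer row vector `p` of length `m`. -/
def linForm {n m : ℕ} (x : Fin n → Fin m → ℝ) (p : Fin m → ℤ) (q : Fin n → ℤ) : Fin m → ℝ :=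
  fun j => (∑ i, (q i : ℝ) * x i j) + (p j : ℝ)

/-- The set of `x` in the unit cube `[0,1]^{nm}` for which `q x + p ∈ B_{|q|}` holds for
infinitely many pairs `(p, q) ∈ ℤ^m × ℤ^n`. The targets `B_k` are subsets of `ℝ^m`. -/
def approxSet (n m : ℕ) (B : ℕ → Set (Fin m → ℝ)) : Set (Fin n → Fin m → ℝ) :=
  {x | (∀ i j, x i j ∈ Set.Icc (0 : ℝ) 1) ∧
    {pq : (Fin m → ℤ) × (Fin n → ℤ) | linForm x pq.1 pq.2 ∈ B (maxNorm pq.2)}.Infinite}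

/-- The concentric case: `B_k` is the open ball of radius `ψ k` about `y`. The distance on
`Fin m → ℝ` is the one of the maximum norm. -/
def approxSetBall (n m : ℕ) (y : Fin m → ℝ) (ψ : ℕ → ℝ≥0) : Set (Fin n → Fin m → ℝ) :=
  approxSet n m fun k => Metric.ball y (ψ k)

/-! The proof is a second-moment argument with weights `φ(N)/N`, carried out on the two-dimensional
torus. Let `f N` count the approximations of norm `N`: in the simultaneous case it is a product of
two ball indicators, and for linear forms it sums over the vectors `(N, b)` with `0 ≤ b < N`. With
mean `m N`, the correlation of `f N` and `f M` for `M ≤ N` is at most `(1 + η) m N m M` plus a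
multiple of `m N (gcd(N, M)/N)²`.

The weights are chosen to tame this error: `∑ φ(M)/M · gcd(N, M)²` over `M ≤ N` is at most `N²`
(`sum_totient_div_mul_gcd_sq_le`). The errors therefore sum to `O(S)`, where `S` is the weighted sum
of the means, while the main term is `(1 + η) S²`. Since `S` is unbounded and `η` arbitrary,
Chebyshev's inequality gives full measure at once, with no zero-one law
(`ae_frequently_ne_zero_of_gcd_correlation`). The argument needs only the first power of `φ(N)/N`;
as this ratio is at most one, the exponent `1 + ε` reduces to it. -/

/-! ### Totient weights and gcd sums. -/

lemma totient_div_le_totient_div_of_dvd {g n : ℕ} (hgn : g ∣ n) (hn : n ≠ 0) :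
    (Nat.totient n : ℝ) / n ≤ (Nat.totient g : ℝ) / g := by
  have key : ∀ k : ℕ, k ≠ 0 → (Nat.totient k : ℝ) / k =
      ((∏ p ∈ k.primeFactors, (1 - (p : ℚ)⁻¹) : ℚ) : ℝ) := by
    intro k hk
    have h := congrArg (fun r : ℚ => (r : ℝ)) (Nat.totient_eq_mul_prod_factors k)
    simp only [Rat.cast_mul, Rat.cast_natCast] at h
    have hk' : (k : ℝ) ≠ 0 := by exact_mod_cast hk
    rw [h]
    field_simp
  have hg : g ≠ 0 := fun h => hn (by simpa [h] using hgn)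
  rw [key n hn, key g hg]
  have : (∏ p ∈ n.primeFactors, (1 - (p : ℚ)⁻¹)) ≤ ∏ p ∈ g.primeFactors, (1 - (p : ℚ)⁻¹) := by
    have h01 : ∀ p ∈ n.primeFactors, 0 ≤ 1 - (p : ℚ)⁻¹ := fun p hp => by
      have hp1 : (1 : ℚ) ≤ p := by exact_mod_cast (Nat.prime_of_mem_primeFactors hp).one_lt.le
      exact sub_nonneg.2 (inv_le_one_of_one_le₀ hp1)
    have hsub := Nat.primeFactors_mono hgn hn
    rw [← Finset.prod_sdiff hsub]
    refine mul_le_of_le_one_left (Finset.prod_nonneg fun p hp => h01 p (hsub hp))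
      (Finset.prod_le_one (fun p hp => h01 p (Finset.mem_sdiff.1 hp).1) fun p _ => ?_)
    simp
  exact_mod_cast this

/-- With `g = gcd(N, M)`, monotonicity replaces `φ(M)/M` by `φ(g)/g`. Enlarging to all common
divisors `g` of `N` and `M`, each `g ∣ N` occurs for `N/g` values of `M` and contributes `φ(g) N`;
then `∑ φ(g) = N`. -/
lemma sum_totient_div_mul_gcd_sq_le (N : ℕ) :
    ∑ M ∈ Finset.Icc 1 N, (Nat.totient M : ℝ) / M * (Nat.gcd N M : ℝ) ^ 2 ≤ (N : ℝ) ^ 2 := by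
  rcases Nat.eq_zero_or_pos N with rfl | hN
  · simp
  calc ∑ M ∈ Finset.Icc 1 N, (Nat.totient M : ℝ) / M * (Nat.gcd N M : ℝ) ^ 2
      ≤ ∑ M ∈ Finset.Icc 1 N, ∑ g ∈ N.divisors,
          if g ∣ M then (Nat.totient g : ℝ) / g * (g : ℝ) ^ 2 else 0 := by
        refine Finset.sum_le_sum fun M hM => ?_
        have hM0 : M ≠ 0 := by have := (Finset.mem_Icc.1 hM).1; omega
        refine le_trans ?_ (Finset.single_le_sum
          (f := fun g : ℕ => if g ∣ M then (Nat.totient g : ℝ) / g * (g : ℝ) ^ 2 else 0)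
          (fun g _ => by split_ifs <;> positivity)
          (Nat.mem_divisors.2 ⟨Nat.gcd_dvd_left N M, hN.ne'⟩))
        simp only [Nat.gcd_dvd_right, if_true]
        exact mul_le_mul_of_nonneg_right
          (totient_div_le_totient_div_of_dvd (Nat.gcd_dvd_right N M) hM0) (by positivity)
    _ = ∑ g ∈ N.divisors, (Nat.totient g : ℝ) * N := by
        rw [Finset.sum_comm]
        refine Finset.sum_congr rfl fun g hg => ?_
        have hgN := Nat.dvd_of_mem_divisors hg
        have hg0 : (g : ℝ) ≠ 0 := by exact_mod_cast (Nat.pos_of_mem_divisors hg).ne'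
        rw [← Finset.sum_filter, Finset.sum_const, nsmul_eq_mul]
        have hcard : ((Finset.Icc 1 N).filter fun M => g ∣ M).card = N / g := by
          rw [← Nat.Ioc_filter_dvd_card_eq_div]
          rfl
        rw [hcard, Nat.cast_div hgN hg0]
        field_simp
    _ = (N : ℝ) ^ 2 := by
        rw [← Finset.sum_mul, ← Nat.cast_sum, Nat.sum_totient, sq]

/-! ### The weighted second-moment argument. -/

/-- A Borel–Cantelli lemma for functions whose correlations are controlled, up to a factor
arbitrarily close to one, by the product of the means and a greatest common divisor term. -/
theorem ae_frequently_ne_zero_of_gcd_correlation {Ω : Type*} [MeasurableSpace Ω] {μ : Measure Ω}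
    [IsProbabilityMeasure μ] (f : ℕ → Ω → ℝ) (hmeas : ∀ N, Measurable (f N))
    (hL2 : ∀ N, MemLp (f N) 2 μ) (hpos : ∀ N x, 0 ≤ f N x)
    (hcor : ∀ η : ℝ, 0 < η → ∃ C : ℝ, 0 ≤ C ∧ ∀ M N : ℕ, 1 ≤ M → M ≤ N →
      ∫ x, f N x * f M x ∂μ ≤ (1 + η) * ((∫ x, f N x ∂μ) * ∫ x, f M x ∂μ) +
        C * ((∫ x, f N x ∂μ) * ((Nat.gcd N M : ℝ) / N) ^ 2))
    (hdiv : ¬ Summable fun N : ℕ => (Nat.totient N : ℝ) / N * ∫ x, f N x ∂μ) :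
    ∀ᵐ x ∂μ, ∃ᶠ N in Filter.atTop, f N x ≠ 0 := by
  simp only [Filter.frequently_atTop]
  rw [ae_all_iff]
  intro q₀
  -- The correlation bound is available only for positive indices.
  set q := max q₀ 1 with hq
  set E : Set Ω := {x | ∀ N, q ≤ N → f N x = 0} with hE
  have hEmeas : MeasurableSet E := by
    have : E = ⋂ N, ⋂ (_ : q ≤ N), f N ⁻¹' {0} := by ext x; simp [hE]
    rw [this]
    exact MeasurableSet.iInter fun N => MeasurableSet.iInter fun _ =>
      hmeas N (measurableSet_singleton 0)
  suffices h0 : μ.real E = 0 by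
    have h0' : μ E = 0 := by simpa [measureReal_eq_zero_iff] using h0
    rw [ae_iff]
    refine measure_mono_null ?_ h0'
    intro x hx N hN
    simp only [Set.mem_ofPred_eq, not_exists, not_and, not_not] at hx
    exact hx N (le_trans (le_max_left _ _) hN)
  set w : ℕ → ℝ := fun N => (Nat.totient N : ℝ) / N with hw
  set m : ℕ → ℝ := fun N => ∫ x, f N x ∂μ with hm
  have hwpos : ∀ N, 0 ≤ w N := fun N => by positivity
  have hmpos : ∀ N, 0 ≤ m N := fun N => integral_nonneg (hpos N)
  have hwm : ∀ N, 0 ≤ w N * m N := fun N => mul_nonneg (hwpos N) (hmpos N)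
  refine le_antisymm (le_of_forall_pos_le_add fun δ hδ => ?_) measureReal_nonneg
  obtain ⟨C, hC, hcorC⟩ := hcor (δ / 2) (by positivity)
  have hlim := (not_summable_iff_tendsto_nat_atTop_of_nonneg hwm).1 hdiv
  -- One half of `δ` is spent on `η`. The threshold `S ≥ 4C/δ` lets the other half absorb the error
  -- `2CS`, and the `+ 1` keeps `S` positive when `C = 0`.
  obtain ⟨Q, hQS, hQq⟩ := ((hlim.eventually_ge_atTop
    (∑ N ∈ Finset.range q, w N * m N + (4 * C / δ + 1))).and
    (Filter.eventually_ge_atTop q)).exists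
  set s := Finset.Ico q Q with hs
  set S : ℝ := ∑ N ∈ s, w N * m N with hSdef
  have hS : 4 * C / δ + 1 ≤ S := by
    have := Finset.sum_range_add_sum_Ico (fun N => w N * m N) hQq
    linarith
  have hSpos : 0 < S := lt_of_lt_of_le (by positivity) hS
  set F : Ω → ℝ := fun x => ∑ N ∈ s, w N * f N x with hF
  have hFL2 : MemLp F 2 μ := memLp_finsetSum s fun N _ => (hL2 N).const_mul (w N)
  have hFint : Integrable F μ := hFL2.integrable one_le_two
  have hIF : ∫ x, F x ∂μ = S := by
    rw [hF, integral_finsetSum _ fun N _ => ((hL2 N).integrable one_le_two).const_mul (w N)]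
    simp only [integral_const_mul, hSdef, hm]
  have hff : ∀ N M, Integrable (fun x => f N x * f M x) μ := fun N M =>
    (hL2 N).integrable_mul (hL2 M)
  have hIFF : ∫ x, F x ^ 2 ∂μ = ∑ N ∈ s, ∑ M ∈ s, w N * w M * ∫ x, f N x * f M x ∂μ := by
    have : ∀ x, F x ^ 2 = ∑ N ∈ s, ∑ M ∈ s, w N * w M * (f N x * f M x) := by
      intro x
      rw [sq, hF, Finset.sum_mul_sum]
      refine Finset.sum_congr rfl fun N _ => Finset.sum_congr rfl fun M _ => by ring
    simp_rw [this]
    rw [integral_finsetSum _ fun N _ => integrable_finsetSum _ fun M _ =>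
      (hff N M).const_mul _]
    refine Finset.sum_congr rfl fun N _ => ?_
    rw [integral_finsetSum _ fun M _ => (hff N M).const_mul _]
    simp only [integral_const_mul]
  -- The error is one-sided, supported on `M ≤ N`. Using `e N M + e M N` counts the diagonal twice,
  -- which is harmless.
  set e : ℕ → ℕ → ℝ := fun N M => if M ≤ N then m N * ((Nat.gcd N M : ℝ) / N) ^ 2 else 0 with he
  have hepos : ∀ N M, 0 ≤ e N M := fun N M => by
    simp only [he]; split_ifs
    · exact mul_nonneg (hmpos N) (sq_nonneg _)
    · exact le_rfl
  have hcor' : ∀ N ∈ s, ∀ M ∈ s, ∫ x, f N x * f M x ∂μ ≤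
      (1 + δ / 2) * (m N * m M) + C * (e N M + e M N) := by
    intro N hN M hM
    have hN1 : 1 ≤ N := le_trans (le_max_right _ _) (Finset.mem_Ico.1 hN).1
    have hM1 : 1 ≤ M := le_trans (le_max_right _ _) (Finset.mem_Ico.1 hM).1
    rcases le_total M N with h | h
    · have h1 := hcorC M N hM1 h
      have h2 : e N M = m N * ((Nat.gcd N M : ℝ) / N) ^ 2 := by simp [he, h]
      have h3 := mul_nonneg hC (hepos M N)
      rw [mul_add, h2]
      linarith
    · have h1 := hcorC N M hN1 h
      have h2 : e M N = m M * ((Nat.gcd M N : ℝ) / M) ^ 2 := by simp [he, h]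
      have h3 := mul_nonneg hC (hepos N M)
      simp_rw [mul_comm (f N _)]
      rw [mul_add, h2, mul_comm (m N)]
      linarith
  have hesum : ∑ N ∈ s, ∑ M ∈ s, w N * w M * e N M ≤ S := by
    refine Finset.sum_le_sum fun N hN => ?_
    have hN1 : 1 ≤ N := le_trans (le_max_right _ _) (Finset.mem_Ico.1 hN).1
    have hN0 : (0 : ℝ) < N := by exact_mod_cast hN1
    calc ∑ M ∈ s, w N * w M * e N M
        ≤ ∑ M ∈ Finset.Icc 1 N, w N * m N / N ^ 2 * (w M * (Nat.gcd N M : ℝ) ^ 2) := by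
          have hsub : s.filter (fun M => M ≤ N) ⊆ Finset.Icc 1 N := by
            intro M hM
            rw [Finset.mem_filter] at hM
            exact Finset.mem_Icc.2
              ⟨le_trans (le_max_right _ _) (Finset.mem_Ico.1 hM.1).1, hM.2⟩
          refine le_trans (le_of_eq ?_) (Finset.sum_le_sum_of_subset_of_nonneg hsub fun M _ _ =>
            mul_nonneg (div_nonneg (hwm N) (sq_nonneg _)) (mul_nonneg (hwpos M) (sq_nonneg _)))
          rw [Finset.sum_filter]
          refine Finset.sum_congr rfl fun M _ => ?_
          simp only [he]
          split_ifs
          · field_simp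
          · simp
      _ ≤ w N * m N / N ^ 2 * N ^ 2 := by
          rw [← Finset.mul_sum]
          exact mul_le_mul_of_nonneg_left (sum_totient_div_mul_gcd_sq_le N)
            (div_nonneg (hwm N) (sq_nonneg _))
      _ = w N * m N := by field_simp
  have hesum' : ∑ N ∈ s, ∑ M ∈ s, w N * w M * e M N ≤ S := by
    rw [Finset.sum_comm]
    refine le_trans (le_of_eq ?_) hesum
    refine Finset.sum_congr rfl fun N _ => Finset.sum_congr rfl fun M _ => by ring
  have hbound : ∫ x, F x ^ 2 ∂μ ≤ (1 + δ / 2) * S ^ 2 + 2 * C * S := by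
    rw [hIFF]
    calc ∑ N ∈ s, ∑ M ∈ s, w N * w M * ∫ x, f N x * f M x ∂μ
        ≤ ∑ N ∈ s, ∑ M ∈ s, w N * w M * ((1 + δ / 2) * (m N * m M) + C * (e N M + e M N)) :=
          Finset.sum_le_sum fun N hN => Finset.sum_le_sum fun M hM =>
            mul_le_mul_of_nonneg_left (hcor' N hN M hM) (mul_nonneg (hwpos N) (hwpos M))
      _ = (1 + δ / 2) * S ^ 2 + C * ∑ N ∈ s, ∑ M ∈ s, w N * w M * e N M +
          C * ∑ N ∈ s, ∑ M ∈ s, w N * w M * e M N := by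
          rw [sq, hSdef, Finset.sum_mul_sum]
          simp only [Finset.mul_sum, ← Finset.sum_add_distrib]
          refine Finset.sum_congr rfl fun N _ => Finset.sum_congr rfl fun M _ => by ring
      _ ≤ _ := by
          have h1 := mul_le_mul_of_nonneg_left hesum hC
          have h2 := mul_le_mul_of_nonneg_left hesum' hC
          linarith
  -- Chebyshev: `F` vanishes on `E`, so `(F - S)²` equals `S²` there.
  have hvar : μ.real E * S ^ 2 ≤ ∫ x, F x ^ 2 ∂μ - S ^ 2 := by
    have h1 : ∫ x, E.indicator (fun _ => S ^ 2) x ∂μ = μ.real E * S ^ 2 := by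
      rw [integral_indicator_const _ hEmeas, smul_eq_mul]
    have hsq : Integrable (fun x => F x ^ 2) μ := hFL2.integrable_sq
    have h2 : ∫ x, (F x ^ 2 - 2 * S * F x + S ^ 2) ∂μ = ∫ x, F x ^ 2 ∂μ - S ^ 2 := by
      have hlin := hFint.const_mul (2 * S)
      have hsub : Integrable (fun x => F x ^ 2 - 2 * S * F x) μ := hsq.sub hlin
      rw [integral_add hsub (integrable_const _), integral_sub hsq hlin, integral_const_mul, hIF]
      simp
      ring
    rw [← h1, ← h2]
    refine integral_mono ((integrable_const _).indicator hEmeas)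
      ((hsq.sub (hFint.const_mul _)).add (integrable_const _)) fun x => ?_
    by_cases hx : x ∈ E
    · have hFx : F x = 0 := Finset.sum_eq_zero fun N hN => by
        rw [hx N (Finset.mem_Ico.1 hN).1, mul_zero]
      simp [hx, hFx]
    · simp only [hx, not_false_eq_true, Set.indicator_of_notMem]
      nlinarith [sq_nonneg (F x - S)]
  have h4 : 4 * C ≤ δ * S := by
    have : 4 * C / δ ≤ S := by linarith
    rwa [div_le_iff₀ hδ, mul_comm S] at this
  have h5 : μ.real E * S ^ 2 ≤ δ * S ^ 2 := by nlinarith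
  have := le_of_mul_le_mul_right h5 (by positivity)
  linarith

/-! ### Balls and their correlations on the circle. -/

instance UnitAddCircle.isProbabilityMeasure_volume :
    IsProbabilityMeasure (volume : Measure UnitAddCircle) :=
  ⟨by simp⟩

lemma UnitAddCircle.volume_real_ball (y : UnitAddCircle) {r : ℝ} (hr : 0 ≤ r) :
    volume.real (Metric.ball y r) = min 1 (2 * r) := by
  rw [measureReal_def, ← measure_congr AddCircle.closedBall_ae_eq_ball,
    AddCircle.volume_closedBall, ENNReal.toReal_ofReal (by positivity)]

/-- The indicator function of a ball in the circle. -/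
noncomputable def ballIndicator (y : UnitAddCircle) (r : ℝ) : UnitAddCircle → ℝ :=
  (Metric.ball y r).indicator 1

lemma ballIndicator_nonneg (y : UnitAddCircle) (r : ℝ) (x : UnitAddCircle) :
    0 ≤ ballIndicator y r x :=
  Set.indicator_nonneg (fun _ _ => zero_le_one) x

lemma ballIndicator_le_one (y : UnitAddCircle) (r : ℝ) (x : UnitAddCircle) :
    ballIndicator y r x ≤ 1 :=
  Set.indicator_le_self' (fun _ _ => zero_le_one) x

lemma ballIndicator_ne_zero_iff {y x : UnitAddCircle} {r : ℝ} :
    ballIndicator y r x ≠ 0 ↔ dist x y < r := by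
  simp [ballIndicator]

@[fun_prop]
lemma measurable_ballIndicator (y : UnitAddCircle) (r : ℝ) : Measurable (ballIndicator y r) :=
  measurable_one.indicator Metric.isOpen_ball.measurableSet

lemma integral_ballIndicator (y : UnitAddCircle) {r : ℝ} (hr : 0 ≤ r) :
    ∫ x, ballIndicator y r x = min 1 (2 * r) := by
  rw [ballIndicator, integral_indicator_one Metric.isOpen_ball.measurableSet,
    UnitAddCircle.volume_real_ball y hr]

lemma integrable_ballIndicator_comp {X : Type*} [MeasurableSpace X] {μ : Measure X}
    [IsFiniteMeasure μ] (y : UnitAddCircle) (r : ℝ) {h : X → UnitAddCircle} (hh : Measurable h) :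
    Integrable (fun x => ballIndicator y r (h x)) μ :=
  Integrable.of_bound ((measurable_ballIndicator y r).comp hh).aestronglyMeasurable 1
    (Filter.Eventually.of_forall fun x => by
      rw [Real.norm_of_nonneg (ballIndicator_nonneg _ _ _)]
      exact ballIndicator_le_one _ _ _)

lemma integrable_ballIndicator_comp_mul {X : Type*} [MeasurableSpace X] {μ : Measure X}
    [IsFiniteMeasure μ] (y y' : UnitAddCircle) (r r' : ℝ) {h h' : X → UnitAddCircle}
    (hh : Measurable h) (hh' : Measurable h') :
    Integrable (fun x => ballIndicator y r (h x) * ballIndicator y' r' (h' x)) μ :=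
  Integrable.of_bound (((measurable_ballIndicator y r).comp hh).mul
    ((measurable_ballIndicator y' r').comp hh')).aestronglyMeasurable 1
    (Filter.Eventually.of_forall fun x => by
      rw [Real.norm_of_nonneg (mul_nonneg (ballIndicator_nonneg _ _ _)
        (ballIndicator_nonneg _ _ _))]
      exact mul_le_one₀ (ballIndicator_le_one _ _ _) (ballIndicator_nonneg _ _ _)
        (ballIndicator_le_one _ _ _))

/-- A coset of the subgroup of order `k` has at most `k |B| + 1` points in a ball `B`. -/
lemma sum_ballIndicator_translates_le {k l : ℕ} (hk : 0 < k) (hkl : Nat.Coprime k l)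
    {u : UnitAddCircle} (hu : addOrderOf u = k) (z y : UnitAddCircle) {r : ℝ} (hr : 0 ≤ r) :
    ∑ j ∈ Finset.range k, ballIndicator y r (z + (l * j) • u) ≤ k * min 1 (2 * r) + 1 := by
  classical
  have hk0 : (0 : ℝ) < k := by exact_mod_cast hk
  set s := (Finset.range k).filter fun j => z + (l * j) • u ∈ Metric.ball y r with hs
  have hsum : ∑ j ∈ Finset.range k, ballIndicator y r (z + (l * j) • u) = s.card := by
    rw [hs, Finset.card_filter]
    push_cast
    refine Finset.sum_congr rfl fun j _ => ?_
    simp [ballIndicator, Set.indicator_apply]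
  rw [hsum]
  -- Differences of coset points are killed by `k`, so distinct points are at least `1/k` apart.
  -- Balls of radius `ρ` around them are disjoint and have volume `1/k`; those centred in the given
  -- ball pack into its `ρ`-enlargement.
  set ρ : ℝ := 1 / (2 * k) with hρ
  have hρ0 : 0 < ρ := by positivity
  have hdisj : (s : Set ℕ).PairwiseDisjoint fun j => Metric.ball (z + (l * j) • u) ρ := by
    intro i hi j hj hij
    refine Metric.ball_disjoint_ball ?_
    have hik : i < k := Finset.mem_range.1 (Finset.mem_filter.1 hi).1
    have hjk : j < k := Finset.mem_range.1 (Finset.mem_filter.1 hj).1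
    set v : UnitAddCircle := (l * i) • u - (l * j) • u with hv
    have hv0 : v ≠ 0 := by
      intro h0
      have h1 : (l * i) • u = (l * j) • u := sub_eq_zero.1 h0
      rw [nsmul_eq_nsmul_iff_modEq, hu] at h1
      have h2 : i ≡ j [MOD k] := Nat.ModEq.cancel_left_of_coprime hkl h1
      exact hij (by rwa [Nat.ModEq, Nat.mod_eq_of_lt hik, Nat.mod_eq_of_lt hjk] at h2)
    have hkv : k • v = 0 := by
      have hku : k • u = 0 := hu ▸ addOrderOf_nsmul_eq_zero u
      rw [hv, nsmul_sub, smul_comm k, smul_comm k, hku, nsmul_zero, nsmul_zero, sub_zero]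
    have hfin : IsOfFinAddOrder v := isOfFinAddOrder_iff_nsmul_eq_zero.2 ⟨k, hk, hkv⟩
    have h1 := AddCircle.le_add_order_smul_norm_of_isOfFinAddOrder hfin hv0
    have h2 : (addOrderOf v : ℝ) ≤ k := by
      exact_mod_cast Nat.le_of_dvd hk (addOrderOf_dvd_of_nsmul_eq_zero hkv)
    rw [nsmul_eq_mul] at h1
    have h3 : 1 ≤ (k : ℝ) * ‖v‖ := h1.trans (mul_le_mul_of_nonneg_right h2 (norm_nonneg _))
    rw [dist_add_left, dist_eq_norm, ← hv]
    have h4 : ρ + ρ = 1 / k := by rw [hρ]; field_simp; norm_num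
    rw [h4, div_le_iff₀ hk0, mul_comm]
    exact h3
  have hsub : (⋃ j ∈ s, Metric.ball (z + (l * j) • u) ρ) ⊆ Metric.ball y (r + ρ) := by
    refine Set.iUnion₂_subset fun j hj => ?_
    refine Metric.ball_subset_ball' ?_
    have := Metric.mem_ball.1 (Finset.mem_filter.1 hj).2
    linarith
  have hvol := measureReal_mono (μ := (volume : Measure UnitAddCircle)) hsub
  rw [measureReal_biUnion_finset hdisj fun j _ => Metric.isOpen_ball.measurableSet,
    UnitAddCircle.volume_real_ball y (by positivity)] at hvol
  simp only [UnitAddCircle.volume_real_ball _ hρ0.le, Finset.sum_const, nsmul_eq_mul] at hvol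
  have h2ρ : 2 * ρ = 1 / k := by rw [hρ]; field_simp
  have hk1 : 1 / (k : ℝ) ≤ 1 := by
    rw [div_le_one hk0]; exact_mod_cast hk
  rw [mul_add, h2ρ, min_eq_right hk1] at hvol
  have h5 : min 1 (2 * r + 1 / k) ≤ min 1 (2 * r) + 1 / (k : ℝ) := by
    rw [← min_add_add_right]
    exact min_le_min (by linarith [show 0 < 1 / (k : ℝ) by positivity]) le_rfl
  have h6 := hvol.trans h5
  calc (s.card : ℝ) = k * (s.card * (1 / k)) := by field_simp
    _ ≤ k * (min 1 (2 * r) + 1 / k) := mul_le_mul_of_nonneg_left h6 hk0.le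
    _ = _ := by field_simp

/-- A continuous surjective endomorphism of a compact group preserves normalized Haar measure;
surjectivity is divisibility of the circle. -/
lemma measurePreserving_nsmul_unitAddCircle {k : ℕ} (hk : k ≠ 0) :
    MeasurePreserving (fun x : UnitAddCircle => k • x) volume volume := by
  have hcont : Continuous (nsmulAddMonoidHom k : UnitAddCircle →+ UnitAddCircle) :=
    continuous_const_smul k
  refine AddMonoidHom.measurePreserving hcont (fun x => ?_) rfl
  obtain ⟨x', hx'⟩ := DivisibleBy.surjective_smul (A := UnitAddCircle) (α := ℤ)
    (n := k) (by exact_mod_cast hk) x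
  exact ⟨x', by simpa using hx'⟩

lemma integral_comp_nsmul_unitAddCircle {k : ℕ} (hk : k ≠ 0) {g : UnitAddCircle → ℝ}
    (hg : Measurable g) : ∫ x, g (k • x) = ∫ x, g x := by
  have h := measurePreserving_nsmul_unitAddCircle hk
  rw [← integral_map h.aemeasurable (h.map_eq.symm ▸ hg.aestronglyMeasurable), h.map_eq]

/-- Average over translations by the `k`-torsion. The first factor is invariant, while `l • x` runs
through a full coset of the `k`-torsion because `l` is prime to `k`, so point counting in a ball
applies. -/
lemma integral_ballIndicator_mul_le_of_coprime {k l : ℕ} (hk : 0 < k) (hkl : Nat.Coprime k l)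
    (y y' : UnitAddCircle) {r r' : ℝ} (hr : 0 ≤ r) (hr' : 0 ≤ r') :
    ∫ x, ballIndicator y r (k • x) * ballIndicator y' r' (l • x) ≤
      min 1 (2 * r) * (min 1 (2 * r') + 1 / k) := by
  have hk0 : (0 : ℝ) < k := by exact_mod_cast hk
  set u : UnitAddCircle := (((1 : ℝ) / k : ℝ) : UnitAddCircle)
  have hu : addOrderOf u = k := AddCircle.addOrderOf_period_div hk
  set g : UnitAddCircle → ℝ :=
    fun x => ballIndicator y r (k • x) * ballIndicator y' r' (l • x) with hg
  have hint : Integrable g := integrable_ballIndicator_comp_mul y y' r r'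
    (measurable_const_smul k) (measurable_const_smul l)
  have h1 : (k : ℝ) * ∫ x, g x = ∫ x, ∑ j ∈ Finset.range k, g (x + j • u) := by
    rw [integral_finsetSum _ fun j _ => hint.comp_add_right (j • u)]
    simp only [integral_add_right_eq_self, Finset.sum_const, Finset.card_range, nsmul_eq_mul]
  have h2 : ∫ x, ∑ j ∈ Finset.range k, g (x + j • u) ≤
      ∫ x : UnitAddCircle, ballIndicator y r (k • x) * (k * min 1 (2 * r') + 1) := by
    refine integral_mono (integrable_finsetSum _ fun j _ => hint.comp_add_right (j • u))
      ((integrable_ballIndicator_comp y r (measurable_const_smul k)).mul_const _) fun x => ?_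
    have hku : ∀ j : ℕ, k • (x + j • u) = k • x := fun j => by
      rw [nsmul_add, smul_comm, ← hu, addOrderOf_nsmul_eq_zero, nsmul_zero, add_zero]
    simp only [hg, hku, ← Finset.mul_sum, nsmul_add, ← mul_smul]
    exact mul_le_mul_of_nonneg_left (sum_ballIndicator_translates_le hk hkl hu _ y' hr')
      (ballIndicator_nonneg _ _ _)
  rw [integral_mul_const, integral_comp_nsmul_unitAddCircle hk.ne' (measurable_ballIndicator y r),
    integral_ballIndicator y hr, ← h1] at h2
  refine le_of_mul_le_mul_left (h2.trans (le_of_eq ?_)) hk0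
  field_simp

lemma integral_ballIndicator_mul_le {N M : ℕ} (hN : 0 < N)
    (y y' : UnitAddCircle) {r r' : ℝ} (hr : 0 ≤ r) (hr' : 0 ≤ r') :
    ∫ x, ballIndicator y r (N • x) * ballIndicator y' r' (M • x) ≤
      min 1 (2 * r) * (min 1 (2 * r') + (Nat.gcd N M : ℝ) / N) := by
  obtain ⟨k, l, hkl, hNk, hMl⟩ := Nat.exists_coprime N M
  set d := Nat.gcd N M with hd
  have hd0 : 0 < d := Nat.gcd_pos_of_pos_left M hN
  have hk : 0 < k := Nat.pos_of_mul_pos_right (hNk ▸ hN)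
  have h := integral_ballIndicator_mul_le_of_coprime hk hkl y y' hr hr'
  -- Substituting `d • x` for `x` turns the coprime pair `(k, l)` back into `(N, M)`.
  rw [← integral_comp_nsmul_unitAddCircle hd0.ne' (by fun_prop)] at h
  simp only [← mul_smul, ← hNk, ← hMl] at h
  have hdN : (d : ℝ) / N = 1 / k := by
    have hd0' : (d : ℝ) ≠ 0 := by exact_mod_cast hd0.ne'
    have hk0' : (k : ℝ) ≠ 0 := by exact_mod_cast hk.ne'
    have : (N : ℝ) = k * d := by exact_mod_cast hNk
    rw [this]
    field_simp
  rwa [hdN]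

/-! ### Correlations of linear forms on the two-dimensional torus. -/

lemma measurePreserving_nsmul_add_nsmul {a : ℕ} (b : ℕ) (ha : a ≠ 0) :
    MeasurePreserving (fun z : UnitAddCircle × UnitAddCircle => a • z.1 + b • z.2)
      (volume.prod volume) volume := by
  let h : UnitAddCircle × UnitAddCircle →+ UnitAddCircle :=
    (nsmulAddMonoidHom a).coprod (nsmulAddMonoidHom b)
  have hcont : Continuous h := (continuous_fst.const_smul a).add (continuous_snd.const_smul b)
  refine AddMonoidHom.measurePreserving hcont (fun t => ?_) (by simp)
  obtain ⟨s, hs⟩ := DivisibleBy.surjective_smul (A := UnitAddCircle) (α := ℤ)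
    (n := a) (by exact_mod_cast ha) t
  exact ⟨(s, 0), by simpa [h] using hs⟩

lemma measurePreserving_pair_of_det_ne_zero {a b c d : ℕ} (hdet : a * d ≠ c * b) :
    MeasurePreserving (fun z : UnitAddCircle × UnitAddCircle =>
        (a • z.1 + b • z.2, c • z.1 + d • z.2))
      (volume.prod volume) (volume.prod volume) := by
  let h : UnitAddCircle × UnitAddCircle →+ UnitAddCircle × UnitAddCircle :=
    ((nsmulAddMonoidHom a).coprod (nsmulAddMonoidHom b)).prod
      ((nsmulAddMonoidHom c).coprod (nsmulAddMonoidHom d))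
  have hcont : Continuous h :=
    ((continuous_fst.const_smul a).add (continuous_snd.const_smul b)).prodMk
      ((continuous_fst.const_smul c).add (continuous_snd.const_smul d))
  refine AddMonoidHom.measurePreserving hcont (fun t => ?_) rfl
  have hD : (a * d - c * b : ℤ) ≠ 0 := sub_ne_zero.2 (by exact_mod_cast hdet)
  obtain ⟨s₁, hs₁⟩ := DivisibleBy.surjective_smul (A := UnitAddCircle) (α := ℤ) hD t.1
  obtain ⟨s₂, hs₂⟩ := DivisibleBy.surjective_smul (A := UnitAddCircle) (α := ℤ) hD t.2
  simp only at hs₁ hs₂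
  -- Cramer's rule: the adjugate matrix applied to the target divided by the determinant.
  refine ⟨((d : ℤ) • s₁ - (b : ℤ) • s₂, (a : ℤ) • s₂ - (c : ℤ) • s₁), Prod.ext ?_ ?_⟩
  · rw [← hs₁]
    simp only [h, AddMonoidHom.prod_apply, AddMonoidHom.coprod_apply, nsmulAddMonoidHom_apply,
      ← natCast_zsmul]
    module
  · rw [← hs₂]
    simp only [h, AddMonoidHom.prod_apply, AddMonoidHom.coprod_apply, nsmulAddMonoidHom_apply,
      ← natCast_zsmul]
    module

lemma MeasureTheory.MeasurePreserving.integral_comp_of_measurable {X Y : Type*}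
    [MeasurableSpace X] [MeasurableSpace Y] {μ : Measure X} {ν : Measure Y} {h : X → Y}
    (hh : MeasurePreserving h μ ν) {g : Y → ℝ} (hg : Measurable g) :
    ∫ x, g (h x) ∂μ = ∫ y, g y ∂ν := by
  rw [← integral_map hh.aemeasurable hg.aestronglyMeasurable, hh.map_eq]

lemma integral_ballIndicator_linear {a b : ℕ} (ha : a ≠ 0) (y : UnitAddCircle) {r : ℝ}
    (hr : 0 ≤ r) :
    ∫ z : UnitAddCircle × UnitAddCircle, ballIndicator y r (a • z.1 + b • z.2)
      ∂(volume.prod volume) = min 1 (2 * r) := by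
  rw [(measurePreserving_nsmul_add_nsmul b ha).integral_comp_of_measurable
    (measurable_ballIndicator y r), integral_ballIndicator y hr]

lemma integral_ballIndicator_linear_mul_of_det_ne_zero {a b c d : ℕ} (hdet : a * d ≠ c * b)
    (y : UnitAddCircle) {r r' : ℝ} (hr : 0 ≤ r) (hr' : 0 ≤ r') :
    ∫ z : UnitAddCircle × UnitAddCircle,
      ballIndicator y r (a • z.1 + b • z.2) * ballIndicator y r' (c • z.1 + d • z.2)
      ∂(volume.prod volume) = min 1 (2 * r) * min 1 (2 * r') := by
  have h := (measurePreserving_pair_of_det_ne_zero hdet).integral_comp_of_measurable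
    (g := fun w => ballIndicator y r w.1 * ballIndicator y r' w.2) (by fun_prop)
  rw [h, integral_prod_mul, integral_ballIndicator y hr, integral_ballIndicator y hr']

/-- Parallel vectors are `k (g, e)` and `l (g, e)` with `k`, `l` coprime. Both forms are multiples
of the single form `g • z.1 + e • z.2`, which is uniformly distributed, so the circle estimate
applies. -/
lemma integral_ballIndicator_linear_mul_le_of_det_eq_zero {N M b c : ℕ} (hN : 0 < N)
    (hdet : N * c = M * b) (y : UnitAddCircle) {r r' : ℝ} (hr : 0 ≤ r)
    (hr' : 0 ≤ r') :
    ∫ z : UnitAddCircle × UnitAddCircle,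
      ballIndicator y r (N • z.1 + b • z.2) * ballIndicator y r' (M • z.1 + c • z.2)
      ∂(volume.prod volume) ≤
        min 1 (2 * r) * (min 1 (2 * r') + (Nat.gcd N M : ℝ) / N) := by
  obtain ⟨k, l, hkl, hNk, hMl⟩ := Nat.exists_coprime N M
  set g := Nat.gcd N M with hg
  have hg0 : 0 < g := Nat.gcd_pos_of_pos_left M hN
  have hk : 0 < k := Nat.pos_of_mul_pos_right (hNk ▸ hN)
  have hdet' : k * c = l * b := by
    rw [hNk, hMl] at hdet
    exact Nat.eq_of_mul_eq_mul_left hg0 (by linarith)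
  obtain ⟨e, rfl⟩ : k ∣ b := hkl.dvd_of_dvd_mul_left ⟨c, hdet'.symm⟩
  obtain rfl : c = l * e := Nat.eq_of_mul_eq_mul_left hk (by rw [hdet']; ring)
  have h := integral_ballIndicator_mul_le_of_coprime hk hkl y y hr hr'
  rw [← (measurePreserving_nsmul_add_nsmul e hg0.ne').integral_comp_of_measurable
    (by fun_prop)] at h
  simp only [smul_add, ← mul_smul, ← hNk, ← hMl] at h
  have hgN : (g : ℝ) / N = 1 / k := by
    have hg0' : (g : ℝ) ≠ 0 := by exact_mod_cast hg0.ne'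
    have hk0' : (k : ℝ) ≠ 0 := by exact_mod_cast hk.ne'
    have : (N : ℝ) = k * g := by exact_mod_cast hNk
    rw [this]
    field_simp
  rwa [hgN]

lemma card_parallel_pairs_le {N M : ℕ} (hN : 0 < N) :
    ((Finset.range N ×ˢ Finset.range M).filter fun p => N * p.2 = M * p.1).card
      ≤ Nat.gcd N M := by
  obtain ⟨k, l, hkl, hNk, hMl⟩ := Nat.exists_coprime N M
  set g := Nat.gcd N M with hg
  have hg0 : 0 < g := Nat.gcd_pos_of_pos_left M hN
  have hk : 0 < k := Nat.pos_of_mul_pos_right (hNk ▸ hN)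
  have hsub : ((Finset.range N ×ˢ Finset.range M).filter fun p => N * p.2 = M * p.1) ⊆
      (Finset.range g).image fun e => (k * e, l * e) := by
    rintro ⟨b, c⟩ hp
    simp only [Finset.mem_filter, Finset.mem_product, Finset.mem_range] at hp
    obtain ⟨⟨hb, -⟩, hdet⟩ := hp
    have hdet' : k * c = l * b := by
      rw [hNk, hMl] at hdet
      exact Nat.eq_of_mul_eq_mul_left hg0 (by linarith)
    obtain ⟨e, rfl⟩ : k ∣ b := hkl.dvd_of_dvd_mul_left ⟨c, hdet'.symm⟩
    obtain rfl : c = l * e := Nat.eq_of_mul_eq_mul_left hk (by rw [hdet']; ring)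
    refine Finset.mem_image.2 ⟨e, Finset.mem_range.2 ?_, rfl⟩
    rw [hNk] at hb
    exact lt_of_mul_lt_mul_left hb (Nat.zero_le k)
  exact (Finset.card_le_card hsub).trans (Finset.card_image_le.trans (by simp))

/-! ### The two divergence theorems on the torus. -/

theorem ae_frequently_simultaneous (ψ : ℕ → ℝ≥0) (y₁ y₂ : UnitAddCircle)
    (hdiv : ¬ Summable fun N : ℕ => (Nat.totient N : ℝ) / N * (min 1 (2 * (ψ N : ℝ))) ^ 2) :
    ∀ᵐ z ∂((volume : Measure UnitAddCircle).prod (volume : Measure UnitAddCircle)),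
      ∃ᶠ N in Filter.atTop,
        ballIndicator y₁ (ψ N) (N • z.1) * ballIndicator y₂ (ψ N) (N • z.2) ≠ 0 := by
  set β : ℕ → ℝ := fun N => min 1 (2 * (ψ N : ℝ)) with hβ
  have hβ0 : ∀ N, 0 ≤ β N := fun N => by positivity
  have hmean : ∀ N : ℕ, N ≠ 0 → ∫ z : UnitAddCircle × UnitAddCircle,
      ballIndicator y₁ (ψ N) (N • z.1) * ballIndicator y₂ (ψ N) (N • z.2)
        ∂(volume.prod volume) = β N ^ 2 := by
    intro N hN
    rw [integral_prod_mul (fun x => ballIndicator y₁ (ψ N) (N • x))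
      (fun x => ballIndicator y₂ (ψ N) (N • x)),
      integral_comp_nsmul_unitAddCircle hN (by fun_prop),
      integral_comp_nsmul_unitAddCircle hN (by fun_prop),
      integral_ballIndicator _ (ψ N).coe_nonneg, integral_ballIndicator _ (ψ N).coe_nonneg, sq]
  have hL2 : ∀ N, MemLp (fun z : UnitAddCircle × UnitAddCircle =>
      ballIndicator y₁ (ψ N) (N • z.1) * ballIndicator y₂ (ψ N) (N • z.2)) 2
      (volume.prod volume) := by
    intro N
    refine MemLp.of_bound (Measurable.aestronglyMeasurable (by fun_prop)) 1
      (Filter.Eventually.of_forall fun z => ?_)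
    rw [Real.norm_of_nonneg (mul_nonneg (ballIndicator_nonneg _ _ _) (ballIndicator_nonneg _ _ _))]
    exact mul_le_one₀ (ballIndicator_le_one _ _ _) (ballIndicator_nonneg _ _ _)
        (ballIndicator_le_one _ _ _)
  have hmeas : ∀ N, Measurable (fun z : UnitAddCircle × UnitAddCircle =>
      ballIndicator y₁ (ψ N) (N • z.1) * ballIndicator y₂ (ψ N) (N • z.2)) :=
    fun N => by fun_prop
  have hpos : ∀ (N : ℕ) (z : UnitAddCircle × UnitAddCircle),
      0 ≤ ballIndicator y₁ (ψ N) (N • z.1) * ballIndicator y₂ (ψ N) (N • z.2) :=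
    fun N z => mul_nonneg (ballIndicator_nonneg _ _ _) (ballIndicator_nonneg _ _ _)
  refine ae_frequently_ne_zero_of_gcd_correlation _ hmeas hL2 hpos
    (fun η hη => ⟨1 + 1 / η, by positivity, ?_⟩) ?_
  · intro M N hM hMN
    have hN : 0 < N := by omega
    rw [hmean N (by omega), hmean M (by omega)]
    have hrw : ∀ z : UnitAddCircle × UnitAddCircle,
        ballIndicator y₁ (ψ N) (N • z.1) * ballIndicator y₂ (ψ N) (N • z.2) *
          (ballIndicator y₁ (ψ M) (M • z.1) * ballIndicator y₂ (ψ M) (M • z.2)) =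
        (ballIndicator y₁ (ψ N) (N • z.1) * ballIndicator y₁ (ψ M) (M • z.1)) *
          (ballIndicator y₂ (ψ N) (N • z.2) * ballIndicator y₂ (ψ M) (M • z.2)) :=
      fun z => by ring
    simp_rw [hrw]
    rw [integral_prod_mul
      (fun x => ballIndicator y₁ (ψ N) (N • x) * ballIndicator y₁ (ψ M) (M • x))
      (fun x => ballIndicator y₂ (ψ N) (N • x) * ballIndicator y₂ (ψ M) (M • x))]
    have h₁ := integral_ballIndicator_mul_le (M := M) hN y₁ y₁ (ψ N).coe_nonneg (ψ M).coe_nonneg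
    have h₂ := integral_ballIndicator_mul_le (M := M) hN y₂ y₂ (ψ N).coe_nonneg (ψ M).coe_nonneg
    set t : ℝ := (Nat.gcd N M : ℝ) / N
    have ht : 0 ≤ t := by positivity
    -- The cross term `2 β t` is split as `η β² + t²/η`; this is the only source of the loss `1 +
    -- η`.
    have key : (β M + t) ^ 2 ≤ (1 + η) * β M ^ 2 + (1 + 1 / η) * t ^ 2 := by
      have h3 : 0 ≤ (η * β M - t) ^ 2 / η := by positivity
      have h4 : (η * β M - t) ^ 2 / η = η * β M ^ 2 - 2 * β M * t + 1 / η * t ^ 2 := by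
        field_simp; ring
      nlinarith
    refine (mul_le_mul h₁ h₂ (integral_nonneg fun x => mul_nonneg (ballIndicator_nonneg _ _ _)
      (ballIndicator_nonneg _ _ _)) (mul_nonneg (hβ0 N) (add_nonneg (hβ0 M) ht))).trans ?_
    have h5 := mul_le_mul_of_nonneg_left key (sq_nonneg (β N))
    refine le_trans (le_of_eq ?_) (h5.trans (le_of_eq ?_)) <;> simp only [hβ] <;> ring
  · convert hdiv using 3 with N
    -- The mean formula fails to cover `N = 0`, but there the weight `φ(0)/0` is zero.
    rcases eq_or_ne N 0 with rfl | hN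
    · simp
    · rw [hmean N hN]

theorem ae_frequently_linear_form (ψ : ℕ → ℝ≥0) (y : UnitAddCircle)
    (hdiv : ¬ Summable fun N : ℕ => (Nat.totient N : ℝ) / N * (N * min 1 (2 * (ψ N : ℝ)))) :
    ∀ᵐ z ∂((volume : Measure UnitAddCircle).prod (volume : Measure UnitAddCircle)),
      ∃ᶠ N in Filter.atTop,
        ∑ b ∈ Finset.range N, ballIndicator y (ψ N) (N • z.1 + b • z.2) ≠ 0 := by
  set β : ℕ → ℝ := fun N => min 1 (2 * (ψ N : ℝ)) with hβ
  have hβ0 : ∀ N, 0 ≤ β N := fun N => by positivity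
  have hmean : ∀ N : ℕ, ∫ z : UnitAddCircle × UnitAddCircle,
      ∑ b ∈ Finset.range N, ballIndicator y (ψ N) (N • z.1 + b • z.2)
        ∂(volume.prod volume) = N * β N := by
    intro N
    rcases eq_or_ne N 0 with rfl | hN
    · simp
    rw [integral_finsetSum _ fun b _ => integrable_ballIndicator_comp y _ (by fun_prop)]
    simp [integral_ballIndicator_linear hN y (ψ N).coe_nonneg, hβ]
  have hL2 : ∀ N : ℕ, MemLp (fun z : UnitAddCircle × UnitAddCircle =>
      ∑ b ∈ Finset.range N, ballIndicator y (ψ N) (N • z.1 + b • z.2)) 2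
      (volume.prod volume) := by
    refine fun N => memLp_finsetSum _ fun b _ => ?_
    refine MemLp.of_bound (Measurable.aestronglyMeasurable (by fun_prop)) 1
      (Filter.Eventually.of_forall fun z => ?_)
    rw [Real.norm_of_nonneg (ballIndicator_nonneg _ _ _)]
    exact ballIndicator_le_one _ _ _
  have hmeas : ∀ N : ℕ, Measurable (fun z : UnitAddCircle × UnitAddCircle =>
      ∑ b ∈ Finset.range N, ballIndicator y (ψ N) (N • z.1 + b • z.2)) :=
    fun N => by fun_prop
  have hpos : ∀ (N : ℕ) (z : UnitAddCircle × UnitAddCircle),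
      0 ≤ ∑ b ∈ Finset.range N, ballIndicator y (ψ N) (N • z.1 + b • z.2) :=
    fun N z => Finset.sum_nonneg fun b _ => ballIndicator_nonneg _ _ _
  refine ae_frequently_ne_zero_of_gcd_correlation _ hmeas hL2 hpos
    (fun η hη => ⟨1, zero_le_one, ?_⟩) ?_
  · intro M N hM hMN
    have hN : 0 < N := by omega
    have hN0 : (0 : ℝ) < N := by exact_mod_cast hN
    rw [hmean N, hmean M]
    set t : ℝ := (Nat.gcd N M : ℝ) / N with ht
    have ht0 : 0 ≤ t := by positivity
    have hint : ∀ b c : ℕ, Integrable (fun z : UnitAddCircle × UnitAddCircle =>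
        ballIndicator y (ψ N) (N • z.1 + b • z.2) * ballIndicator y (ψ M) (M • z.1 + c • z.2))
        (volume.prod volume) := fun b c =>
      integrable_ballIndicator_comp_mul y y _ _ (by fun_prop) (by fun_prop)
    have hterm : ∀ b c : ℕ, ∫ z : UnitAddCircle × UnitAddCircle,
        ballIndicator y (ψ N) (N • z.1 + b • z.2) * ballIndicator y (ψ M) (M • z.1 + c • z.2)
        ∂(volume.prod volume) ≤ β N * β M + if N * c = M * b then β N * t else 0 := by
      intro b c
      split_ifs with h
      · exact (integral_ballIndicator_linear_mul_le_of_det_eq_zero hN h y (ψ N).coe_nonneg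
          (ψ M).coe_nonneg).trans (le_of_eq (mul_add _ _ _))
      · rw [add_zero]
        exact (integral_ballIndicator_linear_mul_of_det_ne_zero h y (ψ N).coe_nonneg (ψ M).coe_nonneg).le
    -- Nonparallel pairs are independent. At most `gcd(N, M) = N t` pairs are parallel, each with
    -- excess `β N * t`, so the total excess is `m N * t²`, as required.
    have hcard : ((((Finset.range N ×ˢ Finset.range M).filter
        fun p => N * p.2 = M * p.1).card : ℕ) : ℝ) ≤ N * t := by
      have : (N : ℝ) * t = Nat.gcd N M := by rw [ht]; field_simp
      rw [this]
      exact_mod_cast card_parallel_pairs_le hN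
    simp_rw [Finset.sum_mul_sum, ← Finset.sum_product']
    rw [integral_finsetSum _ fun p _ => hint p.1 p.2]
    refine (Finset.sum_le_sum fun p _ => hterm p.1 p.2).trans ?_
    rw [Finset.sum_add_distrib, ← Finset.sum_filter, Finset.sum_const, Finset.sum_const,
      Finset.card_product, Finset.card_range, Finset.card_range, nsmul_eq_mul, nsmul_eq_mul]
    have h1 := mul_le_mul_of_nonneg_right hcard (mul_nonneg (hβ0 N) ht0)
    have h2 : 0 ≤ η * (N * β N * (M * β M)) := by
      have := hβ0 N
      have := hβ0 M
      positivity
    push_cast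
    nlinarith
  · simpa only [hmean] using hdiv

/-! ### Passage from the torus to matrices in the unit cube. -/

lemma UnitAddCircle.exists_int_abs_add_lt {t y r : ℝ}
    (h : dist (t : UnitAddCircle) (y : UnitAddCircle) < r) : ∃ p : ℤ, |t + p - y| < r := by
  rw [dist_eq_norm, ← AddCircle.coe_sub, UnitAddCircle.norm_eq] at h
  refine ⟨-round (t - y), ?_⟩
  push_cast
  rwa [show t + -(round (t - y) : ℝ) - y = t - y - round (t - y) by ring]

lemma UnitAddCircle.dist_le_half (x y : UnitAddCircle) : dist x y ≤ 1 / 2 := by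
  rw [dist_eq_norm]
  simpa using AddCircle.norm_le_half_period (1 : ℝ) (x := x - y) one_ne_zero

/-- Transfer of an almost everywhere statement on the two-dimensional torus to the unit square. -/
lemma volume_eq_one_of_ae_torus {X : Type*} [MeasureSpace X] {e : X → ℝ × ℝ}
    (he : MeasurePreserving e volume volume) {A : Set X}
    (hA : ∀ x ∈ A, e x ∈ Set.Icc (0 : ℝ) 1 ×ˢ Set.Icc (0 : ℝ) 1)
    {G : UnitAddCircle × UnitAddCircle → Prop}
    (hG : ∀ᵐ z ∂((volume : Measure UnitAddCircle).prod (volume : Measure UnitAddCircle)), G z)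
    (hGA : ∀ x, e x ∈ Set.Icc (0 : ℝ) 1 ×ˢ Set.Icc (0 : ℝ) 1 →
      G (((e x).1 : UnitAddCircle), ((e x).2 : UnitAddCircle)) → x ∈ A) :
    volume A = 1 := by
  have hmk : MeasurePreserving (fun t : ℝ => (t : UnitAddCircle))
      (volume.restrict (Set.Ioc (0 : ℝ) 1)) volume := by
    simpa using UnitAddCircle.measurePreserving_mk 0
  have h1 := (hmk.prod hmk).quasiMeasurePreserving.ae hG
  have hms : MeasurableSet (Set.Ioc (0 : ℝ) 1 ×ˢ Set.Ioc (0 : ℝ) 1) :=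
    measurableSet_Ioc.prod measurableSet_Ioc
  rw [Measure.prod_restrict, ae_restrict_iff' hms] at h1
  have h2 := he.quasiMeasurePreserving.ae h1
  refine le_antisymm ?_ ?_
  · calc volume A ≤ volume (e ⁻¹' (Set.Icc (0 : ℝ) 1 ×ˢ Set.Icc (0 : ℝ) 1)) :=
          measure_mono hA
      _ = 1 := by
        rw [he.measure_preimage (measurableSet_Icc.prod measurableSet_Icc).nullMeasurableSet,
          Measure.volume_eq_prod, Measure.prod_prod]
        simp
  · calc (1 : ENNReal) = volume (e ⁻¹' (Set.Ioc (0 : ℝ) 1 ×ˢ Set.Ioc (0 : ℝ) 1)) := by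
          rw [he.measure_preimage hms.nullMeasurableSet, Measure.volume_eq_prod,
            Measure.prod_prod]
          simp
      _ ≤ volume A := by
          refine measure_mono_ae ?_
          filter_upwards [h2] with x hx hx'
          exact hGA x (Set.prod_mono Set.Ioc_subset_Icc_self Set.Ioc_subset_Icc_self hx') (hx hx')

lemma measurePreserving_rowVector :
    MeasurePreserving (fun x : Fin 1 → Fin 2 → ℝ => (x 0 0, x 0 1)) volume volume :=
  (volume_preserving_finTwoArrow ℝ).comp (volume_preserving_funUnique (Fin 1) (Fin 2 → ℝ))

lemma measurePreserving_columnVector :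
    MeasurePreserving (fun x : Fin 2 → Fin 1 → ℝ => (x 0 0, x 1 0)) volume volume :=
  (volume_preserving_finTwoArrow ℝ).comp
    (volume_preserving_pi fun _ : Fin 2 => volume_preserving_funUnique (Fin 1) ℝ)

lemma infinite_approx_of_frequently {n m : ℕ} {x : Fin n → Fin m → ℝ}
    {B : ℕ → Set (Fin m → ℝ)}
    (h : ∃ᶠ N in Filter.atTop, ∃ p q, maxNorm q = N ∧ linForm x p q ∈ B N) :
    {pq : (Fin m → ℤ) × (Fin n → ℤ) | linForm x pq.1 pq.2 ∈ B (maxNorm pq.2)}.Infinite := by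
  refine Set.Infinite.of_image (fun pq => maxNorm pq.2)
    ((Nat.frequently_atTop_iff_infinite.1 h).mono ?_)
  rintro N ⟨p, q, rfl, hpq⟩
  exact ⟨(p, q), hpq, rfl⟩

/-- Ball volumes are capped at one, so divergence passes to them only where `ψ N ≤ 1/2`; finitely
many exceptions do not matter. -/
lemma not_summable_of_totient_rpow {ε : ℝ} (hε : 0 < ε) {ψ : ℕ → ℝ≥0} {u v : ℕ → ℝ}
    (hψ : {N | (1 : ℝ) / 2 < ψ N}.Finite) (hu : ∀ N, 0 ≤ u N)
    (huv : ∀ N, (ψ N : ℝ) ≤ 1 / 2 → u N ≤ v N)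
    (h : ¬ Summable fun N : ℕ => ((Nat.totient N : ℝ) / N) ^ (1 + ε) * u N) :
    ¬ Summable fun N : ℕ => (Nat.totient N : ℝ) / N * v N := by
  refine fun hs => h (Summable.of_norm_bounded_eventually hs ?_)
  refine hψ.subset fun N hN => ?_
  by_contra hN'
  refine hN ?_
  have hN' : (ψ N : ℝ) ≤ 1 / 2 := not_lt.1 hN'
  have hw0 : 0 ≤ (Nat.totient N : ℝ) / N := by positivity
  have hw1 : (Nat.totient N : ℝ) / N ≤ 1 :=
    div_le_one_of_le₀ (by exact_mod_cast Nat.totient_le N) (Nat.cast_nonneg N)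
  change ‖((Nat.totient N : ℝ) / N) ^ (1 + ε) * u N‖ ≤ (Nat.totient N : ℝ) / N * v N
  rw [Real.norm_of_nonneg (mul_nonneg (Real.rpow_nonneg hw0 _) (hu N))]
  exact mul_le_mul (Real.rpow_le_self_of_le_one hw0 hw1 (by linarith)) (huv N hN') (hu N) hw0

theorem volume_approxSetBall_one_two {ε : ℝ} (hε : 0 < ε) (ψ : ℕ → ℝ≥0) (y : Fin 2 → ℝ)
    (h : ¬ Summable (fun q : ℕ => ((Nat.totient q : ℝ) / (q : ℝ)) ^ (1 + ε) * (ψ q : ℝ) ^ 2)) :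
    volume (approxSetBall 1 2 y ψ) = 1 := by
  have hae : ∀ᵐ z ∂((volume : Measure UnitAddCircle).prod (volume : Measure UnitAddCircle)),
      ∃ᶠ N in Filter.atTop, ballIndicator (y 0) (ψ N) (N • z.1) *
        ballIndicator (y 1) (ψ N) (N • z.2) ≠ 0 := by
    -- If `ψ` exceeds `1/2` infinitely often, the balls are then the whole circle and every point
    -- qualifies.
    by_cases hψ : {N | (1 : ℝ) / 2 < ψ N}.Finite
    · refine ae_frequently_simultaneous ψ _ _ (not_summable_of_totient_rpow hε hψ
        (fun N => by positivity) (fun N hN => ?_) h)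
      have hψ0 := (ψ N).coe_nonneg
      rw [min_eq_right (by linarith)]
      nlinarith
    · refine Filter.Eventually.of_forall fun z =>
        (Nat.frequently_atTop_iff_infinite.2 hψ).mono fun N hN => ?_
      exact mul_ne_zero
        (ballIndicator_ne_zero_iff.2 ((UnitAddCircle.dist_le_half _ _).trans_lt hN))
        (ballIndicator_ne_zero_iff.2 ((UnitAddCircle.dist_le_half _ _).trans_lt hN))
  refine volume_eq_one_of_ae_torus measurePreserving_rowVector
    (fun x hx => ⟨hx.1 0 0, hx.1 0 1⟩) hae fun x hx hfreq => ⟨?_, ?_⟩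
  · intro i j
    fin_cases i
    fin_cases j
    exacts [hx.1, hx.2]
  · refine infinite_approx_of_frequently (x := x)
      (B := fun k => Metric.ball y (ψ k)) (hfreq.mono fun N hN => ?_)
    obtain ⟨h1, h2⟩ := mul_ne_zero_iff.1 hN
    rw [ballIndicator_ne_zero_iff, ← AddCircle.coe_nsmul] at h1 h2
    obtain ⟨p₁, hp₁⟩ := UnitAddCircle.exists_int_abs_add_lt h1
    obtain ⟨p₂, hp₂⟩ := UnitAddCircle.exists_int_abs_add_lt h2
    refine ⟨![p₁, p₂], ![N], by simp [maxNorm], ?_⟩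
    rw [Metric.mem_ball, dist_pi_lt_iff ((abs_nonneg _).trans_lt hp₁), Fin.forall_fin_two]
    simp only [nsmul_eq_mul] at hp₁ hp₂
    constructor
    · simpa [linForm, Real.dist_eq] using hp₁
    · simpa [linForm, Real.dist_eq] using hp₂

theorem volume_approxSetBall_two_one {ε : ℝ} (hε : 0 < ε) (ψ : ℕ → ℝ≥0) (y : ℝ)
    (h : ¬ Summable (fun q : ℕ =>
      ((Nat.totient q : ℝ) / (q : ℝ)) ^ (1 + ε) * ((q : ℝ) * (ψ q : ℝ)))) :
    volume (approxSetBall 2 1 (fun _ => y) ψ) = 1 := by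
  have hae : ∀ᵐ z ∂((volume : Measure UnitAddCircle).prod (volume : Measure UnitAddCircle)),
      ∃ᶠ N in Filter.atTop,
        ∑ b ∈ Finset.range N, ballIndicator y (ψ N) (N • z.1 + b • z.2) ≠ 0 := by
    by_cases hψ : {N | (1 : ℝ) / 2 < ψ N}.Finite
    · refine ae_frequently_linear_form ψ _ (not_summable_of_totient_rpow hε hψ
        (fun N => by positivity) (fun N hN => ?_) h)
      have hψ0 := (ψ N).coe_nonneg
      rw [min_eq_right (by linarith)]
      exact mul_le_mul_of_nonneg_left (by linarith) (Nat.cast_nonneg N)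
    · refine Filter.Eventually.of_forall fun z =>
        ((Nat.frequently_atTop_iff_infinite.2 hψ).and_eventually
          (Filter.eventually_gt_atTop 0)).mono fun N hN => ?_
      refine (Finset.sum_pos' (fun b _ => ballIndicator_nonneg _ _ _)
        ⟨0, Finset.mem_range.2 hN.2, ?_⟩).ne'
      exact (ballIndicator_nonneg _ _ _).lt_of_ne' (ballIndicator_ne_zero_iff.2
        ((UnitAddCircle.dist_le_half _ _).trans_lt hN.1))
  refine volume_eq_one_of_ae_torus measurePreserving_columnVector
    (fun x hx => ⟨hx.1 0 0, hx.1 1 0⟩) hae fun x hx hfreq => ⟨?_, ?_⟩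
  · intro i j
    fin_cases j
    fin_cases i
    exacts [hx.1, hx.2]
  · refine infinite_approx_of_frequently (x := x)
      (B := fun k => Metric.ball (fun _ => y) (ψ k)) (hfreq.mono fun N hN => ?_)
    obtain ⟨b, hb, hbN⟩ := Finset.exists_ne_zero_of_sum_ne_zero hN
    rw [ballIndicator_ne_zero_iff, ← AddCircle.coe_nsmul, ← AddCircle.coe_nsmul,
      ← AddCircle.coe_add] at hbN
    obtain ⟨p, hp⟩ := UnitAddCircle.exists_int_abs_add_lt hbN
    -- The restriction `b < N` makes the maximum norm of `(N, b)` equal to `N`.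
    refine ⟨![p], ![N, b], ?_, ?_⟩
    · simp [maxNorm, Fin.univ_succ, (Finset.mem_range.1 hb).le]
    · rw [Metric.mem_ball, dist_pi_lt_iff ((abs_nonneg _).trans_lt hp)]
      simp only [nsmul_eq_mul] at hp
      intro j
      fin_cases j
      simpa [linForm, Real.dist_eq, Fin.sum_univ_two] using hp

theorem mainTheorem6 (ε : ℝ) (hε : 0 < ε) :
    (∀ (ψ : ℕ → ℝ≥0) (y : ℝ),
      ¬ Summable (fun q : ℕ =>
        ((Nat.totient q : ℝ) / (q : ℝ)) ^ (1 + ε) * ((q : ℝ) * (ψ q : ℝ))) →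
      volume (approxSetBall 2 1 (fun _ => y) ψ) = 1) ∧
    (∀ (ψ : ℕ → ℝ≥0) (y : Fin 2 → ℝ),
      ¬ Summable (fun q : ℕ =>
        ((Nat.totient q : ℝ) / (q : ℝ)) ^ (1 + ε) * (ψ q : ℝ) ^ 2) →
      volume (approxSetBall 1 2 y ψ) = 1) :=
  ⟨volume_approxSetBall_two_one hε, volume_approxSetBall_one_two hε⟩
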